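/- Let $G$ be a group and $\omega\in Z^3(G,U(1))$ a 3-cocycle (trivial action), and put $$\gamma_{\sigma,\tau}(\rho)=\frac{\omega(\sigma,\tau,\rho)\,\omega(\sigma\tau\rho(\sigma\tau)^{-1},\sigma,\tau)}{\omega(\sigma,\tau\rho\tau^{-1},\tau)}.$$ An $\omega$-twisted Yetter–Drinfeld module over $G$ is a complex vector space $V=\bigoplus_{\sigma\in G}V_\sigma$ with invertible linear operators $v\mapsto\sigma v$ ($\sigma\in G$) such that $\sigma V_\tau\subseteq V_{\sigma\tau\sigma^{-1}}$ and $(\sigma\tau)v=\gamma_{\sigma,\tau}(\rho)\,\sigma(\tau v)$ for all $\sigma,\tau,\rho\in G$ and $v\in V_\rho$. A morphism is a linear map that preserves the grading and commutes with the operators $\sigma$; subobjects and quotients are given by injective and surjective morphisms. The module is unitary if $V$ is a Hilbert space on which each $\sigma\in G$ acts unitarily. It is monomial if $V=\bigoplus_{x\in X}V_x$ for some one-dimensional subspaces $V_x$, each contained in some $V_\sigma$, that are permuted by every element of $G$. The support of $V$ is $\{\sigma\in G: V_\sigma\ne0\}$. Theorem. Let $V$ be a finite-dimensional unitary $\omega$-twisted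 Yetter–Drinfeld module over $G$. (1) If $G$ is generated by finitely many elements each of which has a finite conjugacy class, then there is a finite-dimensional monomial $\omega$-twisted Yetter–Drinfeld module $W$ over $G$ such that $V$ is both a subobject and a quotient of $W$. (2) For an arbitrary group $G$, let $F$ be the subgroup generated by the support of $V$. Then $V$, regarded as an $\omega|_F$-twisted Yetter–Drinfeld module over $F$, is both a subobject and a quotient of one finite-dimensional monomial $\omega|_F$-twisted Yetter–Drinfeld module over $F$. -/

import Mathlib

universe u v

/-- A (not necessarily normalized) 3-cocycle `ω ∈ Z³(G, U(1))`, for the trivial action of `G`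
on the circle group `U(1)`, written multiplicatively. -/
structure ThreeCocycle (G : Type u) [Group G] where
  toFun : G → G → G → Circle
  cocycle : ∀ σ τ ρ κ : G,
    toFun τ ρ κ * toFun σ (τ * ρ) κ * toFun σ τ ρ =
      toFun (σ * τ) ρ κ * toFun σ τ (ρ * κ)

namespace ThreeCocycle

variable {G : Type u} [Group G]

/-- The twisting factor
`γ_{σ,τ}(ρ) = ω(σ,τ,ρ) ω(στρ(στ)⁻¹,σ,τ) / ω(σ,τρτ⁻¹,τ)`. -/
noncomputable def gamma (ω : ThreeCocycle G) (σ τ ρ : G) : Circle :=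
  ω.toFun σ τ ρ * ω.toFun (σ * τ * ρ * (σ * τ)⁻¹) σ τ / ω.toFun σ (τ * ρ * τ⁻¹) τ

/-- The restriction of a 3-cocycle to a subgroup. -/
def restrict (ω : ThreeCocycle G) (F : Subgroup G) : ThreeCocycle F where
  toFun σ τ ρ := ω.toFun σ τ ρ
  cocycle σ τ ρ κ := ω.cocycle σ τ ρ κ

end ThreeCocycle

/-- The structure of an `ω`-twisted Yetter-Drinfeld module on a complex vector space `V`:
a direct sum decomposition `V = ⨁_σ V_σ` indexed by `G`, and for each `σ : G` an invertible
linear map `act σ` of `V`, such that `σ V_τ ⊆ V_{στσ⁻¹}` and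
`(στ) v = γ_{σ,τ}(ρ) σ(τ v)` for all `v ∈ V_ρ`.

As the maps `act σ` are invertible, the identity of `G` acts on `V_ρ` by the scalar
`γ_{1,1}(ρ)⁻¹`, which is `1` when `ω` is normalized; no separate unit axiom is needed. -/
structure TwistedYD {G : Type u} [Group G] (ω : ThreeCocycle G)
    (V : Type v) [AddCommGroup V] [Module ℂ V] where
  grading : G → Submodule ℂ V
  grading_indep : iSupIndep grading
  grading_span : ⨆ σ, grading σ = ⊤
  act : G → V ≃ₗ[ℂ] V
  act_grading : ∀ σ τ : G, ∀ v ∈ grading τ, act σ v ∈ grading (σ * τ * σ⁻¹)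
  act_mul : ∀ σ τ ρ : G, ∀ v ∈ grading ρ,
    act (σ * τ) v = (ω.gamma σ τ ρ : ℂ) • act σ (act τ v)

/-- A monomial structure on a map `π : G → GL(V)`: a decomposition `V = ⨁_{x ∈ X} V_x` into
one-dimensional subspaces which are permuted by every `π σ`. -/
structure MonomialStructure {G : Type u} {V : Type v} [AddCommGroup V] [Module ℂ V]
    (π : G → V ≃ₗ[ℂ] V) where
  X : Type v
  line : X → Submodule ℂ V
  line_indep : iSupIndep line
  line_span : ⨆ x, line x = ⊤
  finrank_line : ∀ x, Module.finrank ℂ (line x) = 1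
  permutes : ∀ σ : G, ∃ p : Equiv.Perm X,
    ∀ x, (line x).map (π σ : V →ₗ[ℂ] V) = line (p x)

namespace TwistedYD

variable {G : Type u} [Group G] {ω : ThreeCocycle G}

/-- The support `{σ ∈ G : V_σ ≠ 0}`. -/
def support {V : Type v} [AddCommGroup V] [Module ℂ V] (M : TwistedYD ω V) : Set G :=
  {σ | M.grading σ ≠ ⊥}

/-- A morphism of `ω`-twisted Yetter-Drinfeld modules: a linear map preserving the grading and
commuting with the twisted action. -/
structure Hom {V W : Type v} [AddCommGroup V] [Module ℂ V] [AddCommGroup W] [Module ℂ W]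
    (M : TwistedYD ω V) (N : TwistedYD ω W) where
  toLinearMap : V →ₗ[ℂ] W
  map_grading : ∀ σ : G, ∀ v ∈ M.grading σ, toLinearMap v ∈ N.grading σ
  map_act : ∀ (σ : G) (v : V), toLinearMap (M.act σ v) = N.act σ (toLinearMap v)

/-- `M` is a subobject of `N`: there is an injective morphism `M → N`. -/
def IsSubobjectOf {V W : Type v} [AddCommGroup V] [Module ℂ V] [AddCommGroup W] [Module ℂ W]
    (M : TwistedYD ω V) (N : TwistedYD ω W) : Prop :=
  ∃ f : Hom M N, Function.Injective f.toLinearMap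

/-- `M` is a quotient of `N`: there is a surjective morphism `N → M`. -/
def IsQuotientOf {V W : Type v} [AddCommGroup V] [Module ℂ V] [AddCommGroup W] [Module ℂ W]
    (M : TwistedYD ω V) (N : TwistedYD ω W) : Prop :=
  ∃ f : Hom N M, Function.Surjective f.toLinearMap

/-- A twisted Yetter-Drinfeld module on a Hilbert space is unitary when every `σ : G` acts by a
unitary operator. Orthogonality of the homogeneous components is not demanded; as this is used
only as a hypothesis, modules with orthogonal components are covered. -/
def IsUnitary {V : Type v} [NormedAddCommGroup V] [InnerProductSpace ℂ V]
    (M : TwistedYD ω V) : Prop :=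
  ∀ (σ : G) (v w : V), inner ℂ (M.act σ v) (M.act σ w) = inner ℂ v w

/-- A twisted Yetter-Drinfeld module is monomial when its twisted action has a monomial
structure, compatible with the grading in the sense that every line is homogeneous. -/
def IsMonomial {V : Type v} [AddCommGroup V] [Module ℂ V] (M : TwistedYD ω V) : Prop :=
  ∃ S : MonomialStructure M.act, ∀ x : S.X, ∃ σ : G, S.line x ≤ M.grading σ

/-- The twisted Yetter-Drinfeld module over the subgroup `F` obtained from `M` by keeping the
space, the homogeneous components and the operators, when the support of `M` lies in `F`. -/
def restrict {V : Type v} [AddCommGroup V] [Module ℂ V] (M : TwistedYD ω V)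
    (F : Subgroup G) (hF : M.support ⊆ F) : TwistedYD (ω.restrict F) V where
  grading σ := M.grading σ
  grading_indep := M.grading_indep.comp Subtype.val_injective
  grading_span := by
    rw [eq_top_iff, ← M.grading_span]
    refine iSup_le fun σ => ?_
    by_cases h : M.grading σ = ⊥
    · simp [h]
    · exact le_iSup (fun τ : F => M.grading τ) ⟨σ, hF h⟩
  act σ := M.act σ
  act_grading σ τ v hv := M.act_grading σ τ v hv
  act_mul σ τ ρ v hv := M.act_mul σ τ ρ v hv

end TwistedYD

/-- Common eigenvectors of a commuting family of linear isometries span the space. -/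
theorem span_common_eigenvectors {E : Type*} [NormedAddCommGroup E] [InnerProductSpace ℂ E]
    [FiniteDimensional ℂ E] {ι : Type*} (f : ι → E →ₗᵢ[ℂ] E)
    (hcomm : ∀ i j x, f i (f j x) = f j (f i x)) :
    Submodule.span ℂ {x : E | ∀ i, ∃ c : ℂ, f i x = c • x} = ⊤ := by
  have hss : ∀ i, Module.End.IsSemisimple (f i).toLinearMap := by
    intro i
    rw [Module.End.isSemisimple_iff]
    intro p hp
    rw [Module.End.mem_invtSubmodule] at hp
    refine ⟨pᗮ, ?_, p.isCompl_orthogonal⟩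
    rw [Module.End.mem_invtSubmodule]
    -- In finite dimension an isometry maps an invariant `p` onto itself, so it also preserves the
    -- orthogonal complement.
    have hmap : p.map (f i).toLinearMap = p :=
      Submodule.eq_of_le_of_finrank_eq (Submodule.map_le_iff_le_comap.mpr hp)
        (LinearEquiv.finrank_eq (Submodule.equivMapOfInjective _ (f i).injective p).symm)
    intro x hx
    rw [Submodule.mem_comap, Submodule.mem_orthogonal]
    intro y hy
    rw [← hmap] at hy
    obtain ⟨y', hy', rfl⟩ := hy
    exact ((f i).inner_map_map y' x).trans ((Submodule.mem_orthogonal p x).mp hx y' hy')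
  have hgen : ∀ i (μ : ℂ), Module.End.maxGenEigenspace (f i).toLinearMap μ =
      Module.End.eigenspace (f i).toLinearMap μ := fun i μ =>
    (hss i).isFinitelySemisimple.maxGenEigenspace_eq_eigenspace μ
  have htop := Module.End.iSup_iInf_maxGenEigenspace_eq_top_of_iSup_maxGenEigenspace_eq_top_of_commute
    (fun i => (f i).toLinearMap) (fun i j _ => LinearMap.ext (hcomm i j))
    (fun i => Module.End.iSup_maxGenEigenspace_eq_top _)
  rw [eq_top_iff, ← htop]
  refine iSup_le fun χ x hx => Submodule.subset_span fun i => ⟨χ i, ?_⟩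
  have hxi := (Submodule.mem_iInf _).mp hx i
  rw [hgen, Module.End.mem_eigenspace_iff] at hxi
  exact hxi

/-- In a group generated by finitely many elements with finite conjugacy classes, the center has
finite index. -/
theorem finiteIndex_center_of_finite_conjugatesOf {G : Type*} [Group G] (S : Finset G)
    (hS : Subgroup.closure (S : Set G) = ⊤) (hfin : ∀ s ∈ S, (conjugatesOf s).Finite) :
    (Subgroup.center G).FiniteIndex := by
  rw [Subgroup.center_eq_infi' hS]
  refine Subgroup.finiteIndex_iInf fun s => ⟨?_⟩
  have hindex : (MulAction.stabilizer (ConjAct G) (s : G)).index ≠ 0 := by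
    rw [MulAction.index_stabilizer, ConjAct.orbit_eq_carrier_conjClasses]
    exact (Set.ncard_pos (hfin s s.2)).mpr ⟨s, mem_conjugatesOf_self⟩ |>.ne'
  rwa [ConjAct.stabilizer_eq_centralizer] at hindex

namespace TwistedYD

variable {G : Type u} [Group G] {ω : ThreeCocycle G} {V : Type v}

section Module

variable [AddCommGroup V] [Module ℂ V] (M : TwistedYD ω V)

theorem conj_mem_support {ρ : G} (hρ : ρ ∈ M.support) (σ : G) : σ * ρ * σ⁻¹ ∈ M.support := by
  obtain ⟨v, hv, hv0⟩ := (Submodule.ne_bot_iff _).mp hρ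
  exact (Submodule.ne_bot_iff _).mpr ⟨M.act σ v, M.act_grading σ ρ v hv, by simpa using hv0⟩

theorem finite_support [FiniteDimensional ℂ V] : M.support.Finite :=
  WellFoundedGT.finite_ne_bot_of_iSupIndep M.grading_indep

/-! ### Tensoring with a permutation module -/

/-- The module of functions from a finite `G`-set to a twisted Yetter-Drinfeld module, that is,
the tensor product with a permutation representation concentrated in degree `1`. -/
noncomputable def pi (ι : Type) [Finite ι] [MulAction G ι] : TwistedYD ω (ι → V) where
  grading ρ := Submodule.pi Set.univ fun _ => M.grading ρ
  grading_indep := by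
    intro ρ
    rw [Submodule.disjoint_def]
    intro f hf hf'
    have hle : (⨆ τ, ⨆ _ : τ ≠ ρ, Submodule.pi Set.univ fun _ : ι => M.grading τ) ≤
        Submodule.pi Set.univ fun _ : ι => ⨆ τ, ⨆ _ : τ ≠ ρ, M.grading τ :=
      iSup₂_le fun τ hτ => Submodule.pi_mono fun _ _ => le_iSup₂_of_le τ hτ le_rfl
    ext i
    exact Submodule.disjoint_def.mp (M.grading_indep ρ) (f i) (hf i trivial)
      (hle hf' i trivial)
  grading_span := by
    classical
    have := Fintype.ofFinite ι
    rw [eq_top_iff]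
    intro f _
    rw [← Finset.univ_sum_single f]
    refine Submodule.sum_mem _ fun i _ => ?_
    have hle : ⊤ ≤ (⨆ ρ, Submodule.pi Set.univ fun _ : ι => M.grading ρ).comap
        (LinearMap.single ℂ (fun _ : ι => V) i) := by
      rw [← M.grading_span]
      refine iSup_le fun ρ v hv => Submodule.mem_iSup_of_mem ρ fun j _ => ?_
      rcases eq_or_ne j i with rfl | h
      · simpa using hv
      · simp [h]
    exact hle (Submodule.mem_top (x := f i))
  act σ := (LinearEquiv.funCongrLeft ℂ V (MulAction.toPerm σ⁻¹ : Equiv.Perm ι)).trans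
    (LinearEquiv.piCongrRight fun _ => M.act σ)
  act_grading σ τ f hf i _ := M.act_grading σ τ _ (hf _ trivial)
  act_mul σ τ ρ f hf := by
    ext i
    simpa [mul_smul, LinearEquiv.funCongrLeft_apply, LinearMap.funLeft_apply] using
      M.act_mul σ τ ρ _ (hf (τ⁻¹ • σ⁻¹ • i) trivial)

variable {ι : Type} [Finite ι] [MulAction G ι]

theorem pi_act_apply (σ : G) (f : ι → V) (i : ι) :
    (M.pi ι).act σ f i = M.act σ (f (σ⁻¹ • i)) := rfl

theorem pi_act_single [DecidableEq ι] (σ : G) (i : ι) (v : V) :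
    (M.pi ι).act σ (Pi.single i v) = Pi.single (σ • i) (M.act σ v) := by
  ext j
  rw [pi_act_apply]
  rcases eq_or_ne j (σ • i) with rfl | h
  · simp
  · rw [Pi.single_eq_of_ne h, Pi.single_eq_of_ne, map_zero]
    rwa [Ne, inv_smul_eq_iff]

theorem isSubobjectOf_pi [Nonempty ι] : M.IsSubobjectOf (M.pi ι) :=
  ⟨{ toLinearMap := LinearMap.pi fun _ => LinearMap.id
     map_grading := fun _ _ hv _ _ => hv
     map_act := fun _ _ => rfl }, fun _ _ h => congrFun h (Classical.arbitrary ι)⟩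

theorem isQuotientOf_pi [Nonempty ι] : M.IsQuotientOf (M.pi ι) := by
  classical
  have := Fintype.ofFinite ι
  refine ⟨{ toLinearMap := ∑ i, LinearMap.proj i, map_grading := ?_, map_act := ?_ }, ?_⟩
  · intro σ f hf
    simpa using Submodule.sum_mem _ fun i _ => hf i trivial
  · intro σ f
    simp only [LinearMap.sum_apply, LinearMap.proj_apply, map_sum, pi_act_apply]
    exact Equiv.sum_comp (MulAction.toPerm σ⁻¹ : Equiv.Perm ι) fun i => M.act σ (f i)
  · intro v
    refine ⟨Pi.single (Classical.arbitrary ι) v, ?_⟩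
    simp [LinearMap.sum_apply]

theorem act_act_eq_smul {σ τ ρ : G} {v : V} (hv : v ∈ M.grading ρ) :
    M.act σ (M.act τ v) = ((ω.gamma σ τ ρ : ℂ))⁻¹ • M.act (σ * τ) v := by
  rw [M.act_mul σ τ ρ v hv, inv_smul_smul₀ (Circle.coe_ne_zero _)]

/-- Write $\sigma g = g'a$ with $a \in H$: the twist and the action of $a$ on `v` contribute only
scalars. -/
theorem act_mem_span_of_forall {H : Subgroup G} {ρ : G} {v : V} (hv : v ∈ M.grading ρ)
    (hH : ∀ a ∈ H, ∃ c : ℂ, M.act a v = c • v) {σ g g' : G} (h : g'⁻¹ * (σ * g) ∈ H) :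
    M.act σ (M.act g v) ∈ Submodule.span ℂ {M.act g' v} := by
  obtain ⟨c, hc⟩ := hH _ h
  rw [M.act_act_eq_smul hv, ← mul_inv_cancel_left g' (σ * g), M.act_mul _ _ ρ v hv, hc, map_smul]
  exact Submodule.smul_mem _ _ (Submodule.smul_mem _ _ (Submodule.smul_mem _ _
    (Submodule.mem_span_singleton_self _)))

/-- If a finite-index subgroup has enough homogeneous common eigenvectors in `V`, then the module
of functions on its coset space is monomial. -/
theorem isMonomial_pi [MulAction.IsPretransitive G ι] (i₀ : ι)
    (hspan : Submodule.span ℂ {v : V | (∃ ρ, v ∈ M.grading ρ) ∧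
      ∀ a ∈ MulAction.stabilizer G i₀, ∃ c : ℂ, M.act a v = c • v} = ⊤) :
    (M.pi ι).IsMonomial := by
  classical
  have := Fintype.ofFinite ι
  obtain ⟨b, hb, hbspan, hbind⟩ := exists_linearIndependent ℂ
    {v : V | (∃ ρ, v ∈ M.grading ρ) ∧
      ∀ a ∈ MulAction.stabilizer G i₀, ∃ c : ℂ, M.act a v = c • v}
  choose g hg using fun i : ι => MulAction.exists_smul_eq G i₀ i
  let B : Module.Basis b ℂ V := Module.Basis.mk hbind (by
    rw [Subtype.range_coe, hbspan, hspan])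
  let C : Module.Basis (Σ _ : ι, b) ℂ (ι → V) := Pi.basis fun i => B.map (M.act (g i))
  have hC : ∀ i e, C ⟨i, e⟩ = Pi.single i (M.act (g i) (e : V)) := by
    intro i e
    simp [C, B]
  refine ⟨{
    X := Σ _ : ι, b
    line := fun x => Submodule.span ℂ {C x}
    line_indep := C.linearIndependent.iSupIndep_span_singleton
    line_span := by rw [← Submodule.span_range_eq_iSup, C.span_eq]
    finrank_line := fun x => finrank_span_singleton (C.ne_zero x)
    permutes := fun σ => ⟨Equiv.sigmaCongrLeft (β := fun _ => b) (MulAction.toPerm σ), ?_⟩ },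
    ?_⟩
  · rintro ⟨i, e⟩
    have hmem : (M.pi ι).act σ (C ⟨i, e⟩) ∈ Submodule.span ℂ {C ⟨σ • i, e⟩} := by
      obtain ⟨⟨ρ, hρ⟩, hev⟩ := hb e.2
      -- Both `σ * g i` and `g (σ • i)` carry `i₀` to `σ • i`, so they differ by an element of the
      -- stabilizer.
      have h := M.act_mem_span_of_forall (σ := σ) (g := g i) (g' := g (σ • i)) hρ hev (by
        rw [MulAction.mem_stabilizer_iff, mul_smul, mul_smul, hg, inv_smul_eq_iff, hg])
      obtain ⟨c, hc⟩ := Submodule.mem_span_singleton.mp h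
      rw [hC, hC, pi_act_single, ← hc]
      refine Submodule.mem_span_singleton.mpr ⟨c, ?_⟩
      rw [← Pi.single_smul]
    refine Submodule.eq_of_le_of_finrank_eq ?_ ?_
    · rw [Submodule.map_span_le]
      rintro _ rfl
      exact hmem
    · rw [LinearEquiv.finrank_map_eq, finrank_span_singleton (C.ne_zero _),
        finrank_span_singleton (C.ne_zero _)]
  · rintro ⟨i, e⟩
    obtain ⟨⟨ρ, hρ⟩, -⟩ := hb e.2
    refine ⟨g i * ρ * (g i)⁻¹, ?_⟩
    rw [Submodule.span_singleton_le_iff_mem, hC]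
    intro j _
    rcases eq_or_ne j i with rfl | h
    · simpa using M.act_grading _ _ _ hρ
    · simp [h]

/-! ### Commutation of central elements -/

theorem act_mem_grading_of_mem_center {a ρ : G} (ha : a ∈ Subgroup.center G) {v : V}
    (hv : v ∈ M.grading ρ) : M.act a v ∈ M.grading ρ := by
  have h := M.act_grading a ρ v hv
  rwa [← Subgroup.mem_center_iff.mp ha ρ, mul_inv_cancel_right] at h

/-- The scalar by which the operators of two central elements fail to commute in degree `ρ`. -/
noncomputable def commFactor (ω : ThreeCocycle G) (ρ a b : G) : Circle :=
  ω.gamma b a ρ / ω.gamma a b ρ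

theorem act_act_comm {a b ρ : G} (ha : a ∈ Subgroup.center G) {v : V} (hv : v ∈ M.grading ρ) :
    M.act a (M.act b v) = (commFactor ω ρ a b : ℂ) • M.act b (M.act a v) := by
  rw [M.act_act_eq_smul hv, ← Subgroup.mem_center_iff.mp ha b, M.act_mul b a ρ v hv, smul_smul,
    commFactor, Circle.coe_div, div_eq_inv_mul]

theorem commFactor_mul_swap (ρ a b : G) : commFactor ω ρ a b * commFactor ω ρ b a = 1 := by
  simp [commFactor]

/-- In a degree of the support, the commutation factor is multiplicative on the center. -/
noncomputable def commHom {ρ : G} (hρ : ρ ∈ M.support) (b : Subgroup.center G) :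
    Subgroup.center G →* Circle :=
  MonoidHom.mk' (fun a => commFactor ω ρ a b) (by
    intro a a'
    obtain ⟨v, hv, hv0⟩ := (Submodule.ne_bot_iff _).mp hρ
    have hne : M.act b (M.act (a * a' : G) v) ≠ 0 := by simpa using hv0
    refine Circle.ext (smul_left_injective ℂ hne ?_)
    -- Central elements keep the degree `ρ`, so expanding `a * a'` gives the same factor `γ` on both
    -- sides, and it cancels.
    have ha' := M.act_mem_grading_of_mem_center a'.2 hv
    have hb := M.act_mem_grading_of_mem_center b.2 hv
    have h1 := M.act_act_comm (b := b) (mul_mem a.2 a'.2) hv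
    rw [M.act_mul _ _ ρ _ hb, M.act_act_comm a'.2 hv, map_smul, M.act_act_comm a.2 ha',
      smul_smul, smul_smul, mul_comm, mul_left_comm, mul_comm, mul_smul, ← map_smul,
      ← map_smul, ← M.act_mul _ _ ρ _ hv, map_smul] at h1
    exact h1.symm)

theorem commHom_apply {ρ : G} (hρ : ρ ∈ M.support) (b a : Subgroup.center G) :
    M.commHom hρ b a = commFactor ω ρ a b := rfl

/-- If `v` is an eigenvector of `b` with eigenvalue `μ`, then `a v` is one with eigenvalue `μ`
divided by the commutation factor; `b` has finitely many eigenvalues. -/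
theorem finite_range_commHom [FiniteDimensional ℂ V] {ρ : G} (hρ : ρ ∈ M.support)
    (b : Subgroup.center G) : Finite (M.commHom hρ b).range := by
  have : Nontrivial (M.grading ρ) := Submodule.nontrivial_iff_ne_bot.mpr hρ
  let f : Module.End ℂ (M.grading ρ) := (M.act b : V →ₗ[ℂ] V).restrict
    fun v hv => M.act_mem_grading_of_mem_center b.2 hv
  obtain ⟨μ, hμ⟩ := Module.End.exists_eigenvalue f
  obtain ⟨v, hv⟩ := hμ.exists_hasEigenvector
  have hbv : M.act b (v : V) = μ • (v : V) := congrArg Subtype.val hv.apply_eq_smul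
  have hv0 : (v : V) ≠ 0 := fun h => hv.2 (Subtype.ext h)
  have hμ0 : μ ≠ 0 := by
    rintro rfl
    rw [zero_smul] at hbv
    exact hv0 (by simpa using hbv)
  have hmaps : Set.MapsTo (fun z : Circle => μ * (z : ℂ)⁻¹) (M.commHom hρ b).range
      {ν | Module.End.HasEigenvalue (M.act b : V →ₗ[ℂ] V) ν} := by
    rintro _ ⟨a, rfl⟩
    refine Module.End.hasEigenvalue_of_hasEigenvector (x := M.act a v)
      (Module.End.hasEigenvector_iff.mpr ⟨Module.End.mem_eigenspace_iff.mpr ?_, by simpa using hv0⟩)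
    have h := M.act_act_comm (b := b) a.2 v.2
    rw [hbv, map_smul] at h
    change M.act b (M.act a v) = (μ * (commFactor ω ρ a b : ℂ)⁻¹) • M.act a v
    rw [mul_comm, mul_smul, h, inv_smul_smul₀ (Circle.coe_ne_zero _)]
  refine (Set.Finite.of_injOn hmaps ?_ (Module.End.finite_hasEigenvalue _)).to_subtype
  intro z _ w _ h
  exact Circle.ext (inv_injective (mul_left_cancel₀ hμ0 h))

/-- If the center is finitely generated, then a subgroup of finite index in the center acts by
commuting operators on every homogeneous component. -/
theorem exists_finiteIndex_commuting [FiniteDimensional ℂ V] [Group.FG (Subgroup.center G)] :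
    ∃ A : Subgroup (Subgroup.center G), A.FiniteIndex ∧
      ∀ a ∈ A, ∀ b ∈ A, ∀ ρ, ∀ v ∈ M.grading ρ,
        M.act (a : G) (M.act (b : G) v) = M.act (b : G) (M.act (a : G) v) := by
  obtain ⟨T, hT⟩ := Group.fg_def.mp (inferInstance : Group.FG (Subgroup.center G))
  have := M.finite_support.to_subtype
  refine ⟨⨅ p : M.support × T, (M.commHom p.1.2 p.2).ker, ?_, ?_⟩
  · refine Subgroup.finiteIndex_iInf fun p => ?_
    have := M.finite_range_commHom p.1.2 p.2
    infer_instance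
  · intro a ha b _ ρ v hv
    by_cases hρ : ρ ∈ M.support
    · have hker : (M.commHom hρ a).ker = ⊤ := by
        rw [eq_top_iff, ← hT, Subgroup.closure_le]
        intro t ht
        have h1 : commFactor ω ρ a t = 1 := Subgroup.mem_iInf.mp ha (⟨ρ, hρ⟩, ⟨t, ht⟩)
        have h2 := commFactor_mul_swap (ω := ω) ρ a t
        rw [h1, one_mul] at h2
        exact h2
      have hb : commFactor ω ρ b a = 1 := (hker ▸ Subgroup.mem_top b : b ∈ (M.commHom hρ a).ker)
      rw [M.act_act_comm (b := (a : G)) b.2 hv, hb, Circle.coe_one, one_smul]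
    · have hbot : M.grading ρ = ⊥ := not_not.mp hρ
      rw [hbot, Submodule.mem_bot] at hv
      simp [hv]

end Module

/-! ### Unitary modules and the theorem -/

variable [NormedAddCommGroup V] [InnerProductSpace ℂ V] [FiniteDimensional ℂ V]
  (M : TwistedYD ω V)

theorem span_homogeneous_eigenvectors (hM : M.IsUnitary) (A : Subgroup (Subgroup.center G))
    (hA : ∀ a ∈ A, ∀ b ∈ A, ∀ ρ, ∀ v ∈ M.grading ρ,
      M.act (a : G) (M.act (b : G) v) = M.act (b : G) (M.act (a : G) v)) :
    Submodule.span ℂ {v : V | (∃ ρ, v ∈ M.grading ρ) ∧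
      ∀ a ∈ A.map (Subgroup.center G).subtype, ∃ c : ℂ, M.act a v = c • v} = ⊤ := by
  rw [eq_top_iff, ← M.grading_span]
  refine iSup_le fun ρ => ?_
  -- Working inside one degree keeps the eigenvectors homogeneous and needs no orthogonality between
  -- degrees.
  let f : A → M.grading ρ →ₗᵢ[ℂ] M.grading ρ := fun a =>
    LinearMap.isometryOfInner ((M.act (a : G) : V →ₗ[ℂ] V).restrict
      fun v hv => M.act_mem_grading_of_mem_center a.1.2 hv) fun v w => hM _ _ _
  have h := span_common_eigenvectors f fun a b v => Subtype.ext (hA a a.2 b b.2 ρ v v.2)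
  rw [← Submodule.map_subtype_top (M.grading ρ), ← h, Submodule.map_span_le]
  intro v hv
  refine Submodule.subset_span ⟨⟨ρ, v.2⟩, ?_⟩
  rintro _ ⟨a, ha, rfl⟩
  obtain ⟨c, hc⟩ := hv ⟨a, ha⟩
  exact ⟨c, congrArg Subtype.val hc⟩

theorem exists_monomial (hM : M.IsUnitary)
    (hG : ∃ S : Finset G, Subgroup.closure (S : Set G) = ⊤ ∧ ∀ s ∈ S, (conjugatesOf s).Finite) :
    ∃ (W : Type v) (_ : AddCommGroup W) (_ : Module ℂ W) (N : TwistedYD ω W),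
      FiniteDimensional ℂ W ∧ N.IsMonomial ∧ M.IsSubobjectOf N ∧ M.IsQuotientOf N := by
  obtain ⟨S, hS, hfin⟩ := hG
  have hZ := finiteIndex_center_of_finite_conjugatesOf S hS hfin
  have : Group.FG G := Group.fg_iff.mpr ⟨S, hS, S.finite_toSet⟩
  -- Schreier's lemma: a finite-index subgroup of a finitely generated group is finitely generated.
  have : Group.FG (Subgroup.center G) := inferInstance
  obtain ⟨A, hAfin, hA⟩ := M.exists_finiteIndex_commuting
  have hspan := M.span_homogeneous_eigenvectors hM A hA
  set H := A.map (Subgroup.center G).subtype with hH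
  have : H.FiniteIndex := ⟨by
    rw [hH, Subgroup.index_map_subtype]
    exact mul_ne_zero hAfin.index_ne_zero hZ.index_ne_zero⟩
  -- The cosets are relabelled by `Fin n` so that the function space stays in the universe of `V`.
  obtain ⟨n, ⟨e⟩⟩ := Finite.exists_equiv_fin (G ⧸ H)
  let _ : MulAction G (Fin n) := e.symm.mulAction G
  have hsmul : ∀ (σ : G) (q : G ⧸ H), σ • e q = e (σ • q) := fun σ q => by
    rw [e.symm.smul_def, e.symm_apply_apply, e.symm_symm]
  have : MulAction.IsPretransitive G (Fin n) := ⟨fun i j => by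
    obtain ⟨σ, hσ⟩ := MulAction.exists_smul_eq G (e.symm i) (e.symm j)
    exact ⟨σ, by rw [← e.apply_symm_apply i, hsmul, hσ, e.apply_symm_apply]⟩⟩
  have hstab : MulAction.stabilizer G (e ((1 : G) : G ⧸ H)) = H := by
    ext σ
    rw [MulAction.mem_stabilizer_iff, hsmul, e.apply_eq_iff_eq, ← MulAction.mem_stabilizer_iff,
      MulAction.stabilizer_quotient]
  have : Nonempty (Fin n) := ⟨e ((1 : G) : G ⧸ H)⟩
  exact ⟨Fin n → V, inferInstance, inferInstance, M.pi (Fin n), inferInstance,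
    M.isMonomial_pi (e ((1 : G) : G ⧸ H)) (by rw [hstab]; exact hspan),
    M.isSubobjectOf_pi, M.isQuotientOf_pi⟩

/-- The subgroup generated by the support is generated by finitely many elements with finite
conjugacy classes. -/
theorem exists_finset_closure_support :
    ∃ S : Finset (Subgroup.closure M.support),
      Subgroup.closure (S : Set (Subgroup.closure M.support)) = ⊤ ∧
      ∀ s ∈ S, (conjugatesOf s).Finite := by
  have hfin : (((↑) : Subgroup.closure M.support → G) ⁻¹' M.support).Finite :=
    M.finite_support.preimage Subtype.val_injective.injOn
  refine ⟨hfin.toFinset, by simp, fun s hs => hfin.subset fun t ht => ?_⟩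
  obtain ⟨c, rfl⟩ := isConj_iff.mp ht
  exact M.conj_mem_support (hfin.mem_toFinset.mp hs) c

end TwistedYD


theorem mainTheorem6 {G : Type u} [Group G] (ω : ThreeCocycle G)
    {V : Type v} [NormedAddCommGroup V] [InnerProductSpace ℂ V] [FiniteDimensional ℂ V]
    (M : TwistedYD ω V) (hM : M.IsUnitary) :
    ((∃ S : Finset G, Subgroup.closure (S : Set G) = ⊤ ∧ ∀ s ∈ S, (conjugatesOf s).Finite) →
      ∃ (W : Type v) (_ : AddCommGroup W) (_ : Module ℂ W) (N : TwistedYD ω W),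
        FiniteDimensional ℂ W ∧ N.IsMonomial ∧ M.IsSubobjectOf N ∧ M.IsQuotientOf N) ∧
    (∃ (W : Type v) (_ : AddCommGroup W) (_ : Module ℂ W)
        (N : TwistedYD (ω.restrict (Subgroup.closure M.support)) W),
      FiniteDimensional ℂ W ∧ N.IsMonomial ∧
        (M.restrict (Subgroup.closure M.support) Subgroup.subset_closure).IsSubobjectOf N ∧
        (M.restrict (Subgroup.closure M.support) Subgroup.subset_closure).IsQuotientOf N) := by
  exact ⟨M.exists_monomial hM, (M.restrict _ Subgroup.subset_closure).exists_monomial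
    (fun σ => hM σ) M.exists_finset_closure_support⟩
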